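/- The class of \emph{finite description linear orders} is the smallest class of linear orders that contains the empty order $\mathbf 0$ and the one-point order $\mathbf 1$ and is closed under order isomorphisms, binary sums $L_0+L_1$, the products $L\cdot\omega$ and $L\cdot\omega^*$ (the ordered sums of copies of $L$ indexed by $\mathbb N$ and by $\mathbb N$ with the reversed order, respectively), and finitary shuffles $\Xi(L_0,\dots,L_{n-1})=\sum_{r\in\mathbb Q}L_{\chi(r)}$ for $n\ge 1$, where $\chi:\mathbb Q\to\{0,\dots,n-1\}$ is a colouring all of whose colour classes are dense in $\mathbb Q$. A (deterministic finite) automaton over $\{0,1\}$ consists of a finite set $Q$ of states, a start state $q_s\in Q$, a set $F\subseteq Q$ of accept states and a partial transition function $\delta:Q\times\{0,1\}\to Q$. It accepts a word if the run from $q_s$ on that word is defined and ends in $F$; its language $L(M)$ is the set of accepted words. The inorder $<_{2}$ on $\{0,1\}^*$ is defined for distinct words $x,y$ as follows: if $w$ is their longest common prefix, $x=wx'$ and $y=wy'$, then $x<_{2}y$ if and only if $x'$ begins with $0$ or $y'$ begins with $1$. The \emph{linguage} of $M$ is the linear order $\mathbf L(M)=(L(M),<_{2})$. \textbf{Theorem.}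 A linear order $L$ is a finite description linear order if and only if it is order-isomorphic to the linguage $\mathbf L(M)$ of some automaton $M$ over $\{0,1\}$. -/

import Mathlib

universe u

/-! ### Finite description linear orders -/

/-- A colouring of the rationals by `n` colours is homogeneous if every colour class is dense. -/
def IsHomogeneousColoring {n : ℕ} (χ : ℚ → Fin n) : Prop :=
  ∀ k : Fin n, Dense (χ ⁻¹' {k})

/-- The smallest class of linear orders containing the empty order and the one-point order and
closed under binary sums, multiplication by `ω` and by `ω*`, finitary shuffles, and order
isomorphisms.

* `L₀ ⊕ₗ L₁` is the sum `L₀ + L₁`;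
* `ℕ ×ₗ L` and `ℕᵒᵈ ×ₗ L` (the first coordinate decides first) are the products `L · ω` and
  `L · ω*`, that is, copies of `L` indexed by `ω` and `ω*`;
* `Σₗ r : ℚ, L (χ r)` is the shuffle of `L 0, …, L (n - 1)`. -/
inductive IsFiniteDescription : (L : Type u) → [LinearOrder L] → Prop
  | zero : IsFiniteDescription PEmpty.{u + 1}
  | one : IsFiniteDescription PUnit.{u + 1}
  | add (L₀ L₁ : Type u) [LinearOrder L₀] [LinearOrder L₁] :
      IsFiniteDescription L₀ → IsFiniteDescription L₁ → IsFiniteDescription (L₀ ⊕ₗ L₁)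
  | mul_omega (L : Type u) [LinearOrder L] :
      IsFiniteDescription L → IsFiniteDescription (ℕ ×ₗ L)
  | mul_omega_star (L : Type u) [LinearOrder L] :
      IsFiniteDescription L → IsFiniteDescription (ℕᵒᵈ ×ₗ L)
  | shuffle (n : ℕ) (L : Fin n → Type u) [∀ k, LinearOrder (L k)] (χ : ℚ → Fin n) :
      IsHomogeneousColoring χ → (∀ k, IsFiniteDescription (L k)) →
      IsFiniteDescription (Σₗ r : ℚ, L (χ r))
  | iso (L L' : Type u) [LinearOrder L] [LinearOrder L'] :
      L ≃o L' → IsFiniteDescription L → IsFiniteDescription L'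

/-! ### Deterministic automata with a partial transition function -/

/-- An automaton over the alphabet `α` with states `Q`, whose transition function is partial
(`none` means undefined). Finiteness of `Q` is required where automata are used. -/
structure PartialDFA (α : Type*) (Q : Type*) where
  /-- the partial transition function -/
  step : Q → α → Option Q
  /-- the start state -/
  start : Q
  /-- the set of accept states -/
  accept : Set Q

namespace PartialDFA

variable {α Q : Type*} (M : PartialDFA α Q)

/-- The state in which the run on a word ends, when the run is defined. -/
def evalFrom (q : Q) : List α → Option Q
  | [] => some q
  | a :: x => (M.step q a).bind fun p => evalFrom p x

/-- The run on `xa` is the run on `x` followed by the transition along `a`. -/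
theorem evalFrom_append_singleton (q : Q) (x : List α) (a : α) :
    M.evalFrom q (x ++ [a]) = (M.evalFrom q x).bind fun p => M.step p a := by
  induction x generalizing q with
  | nil => cases h : M.step q a <;> simp [evalFrom, h]
  | cons b x ih => cases h : M.step q b <;> simp [evalFrom, h, ih]

/-- The set of words on which the run is defined and ends in an accept state. -/
def language : Language α :=
  {x | ∃ q ∈ M.accept, M.evalFrom M.start x = some q}

end PartialDFA

/-! ### The inorder on binary words -/

/-- Words over `{0, 1}`, with `false` for `0` and `true` for `1`. This is a copy of `List Bool`
that carries the inorder instead of the lexicographic order. -/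
def BinWord : Type := List Bool

/-- The inorder relation: `x` precedes `y` if `x ≠ y` and, writing `x = w x'` and `y = w y'` with
`w` the longest common prefix, `x'` begins with `0` or `y'` begins with `1`. -/
def InorderLT (x y : List Bool) : Prop :=
  x ≠ y ∧ ∃ w x' y' : List Bool, x = w ++ x' ∧ y = w ++ y' ∧
    (∀ v : List Bool, v <+: x → v <+: y → v.length ≤ w.length) ∧
    ([false] <+: x' ∨ [true] <+: y')

theorem not_inorderLT_nil_nil : ¬ InorderLT [] [] := fun h => h.1 rfl

theorem inorderLT_nil_cons (b : Bool) (y : List Bool) :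
    InorderLT [] (b :: y) ↔ b = true := by
  constructor
  · rintro ⟨-, w, x', y', hx, hy, -, h⟩
    obtain ⟨rfl, rfl⟩ := List.append_eq_nil_iff.1 hx.symm
    rw [List.nil_append] at hy
    subst hy
    simpa [eq_comm] using h
  · rintro rfl
    exact ⟨by simp, [], [], true :: y, by simp, by simp,
      fun v hv _ => by simp [List.prefix_nil.1 hv], Or.inr (by simp)⟩

theorem inorderLT_cons_nil (a : Bool) (x : List Bool) :
    InorderLT (a :: x) [] ↔ a = false := by
  constructor
  · rintro ⟨-, w, x', y', hx, hy, -, h⟩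
    obtain ⟨rfl, rfl⟩ := List.append_eq_nil_iff.1 hy.symm
    rw [List.nil_append] at hx
    subst hx
    simpa [eq_comm] using h
  · rintro rfl
    exact ⟨by simp, [], false :: x, [], by simp, by simp,
      fun v _ hv => by simp [List.prefix_nil.1 hv], Or.inl (by simp)⟩

theorem inorderLT_cons_cons (a b : Bool) (x y : List Bool) :
    InorderLT (a :: x) (b :: y) ↔ (a = false ∧ b = true) ∨ (a = b ∧ InorderLT x y) := by
  constructor
  · rintro ⟨hne, w, x', y', hx, hy, hmax, h⟩
    cases w with
    | nil =>
      rw [List.nil_append] at hx hy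
      subst hx hy
      by_cases hab : a = b
      · subst hab
        have := hmax [a] (by simp) (by simp)
        simp at this
      · left
        cases a <;> cases b <;> simp_all
    | cons c w =>
      simp only [List.cons_append, List.cons.injEq] at hx hy
      obtain ⟨rfl, rfl⟩ := hx
      obtain ⟨rfl, rfl⟩ := hy
      refine Or.inr ⟨rfl, fun he => hne (by rw [he]), w, x', y', rfl, rfl, fun v h1 h2 => ?_, h⟩
      have := hmax (b :: v) (by simpa using h1) (by simpa using h2)
      simpa using this
  · rintro (⟨rfl, rfl⟩ | ⟨rfl, hne, w, x', y', rfl, rfl, hmax, h⟩)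
    · refine ⟨by simp, [], false :: x, true :: y, rfl, rfl, fun v h1 h2 => ?_, by simp⟩
      cases v with
      | nil => simp
      | cons c v =>
        have e1 := (List.cons_prefix_cons.1 h1).1
        have e2 := (List.cons_prefix_cons.1 h2).1
        simp [e1] at e2
    · refine ⟨by simpa using hne, a :: w, x', y', rfl, rfl, fun v h1 h2 => ?_, h⟩
      cases v with
      | nil => simp
      | cons c v =>
        have := hmax v (List.cons_prefix_cons.1 h1).2 (List.cons_prefix_cons.1 h2).2
        simpa using this

theorem inorderLT_trans : ∀ x y z : List Bool, InorderLT x y → InorderLT y z → InorderLT x z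
  | [], [], _, h, _ => absurd h not_inorderLT_nil_nil
  | _, [], [], _, h => absurd h not_inorderLT_nil_nil
  | [], b :: y, [], h1, h2 => by
    rw [inorderLT_nil_cons] at h1
    rw [inorderLT_cons_nil] at h2
    simp [h1] at h2
  | [], b :: y, c :: z, h1, h2 => by
    rw [inorderLT_nil_cons] at h1 ⊢
    rw [inorderLT_cons_cons] at h2
    grind
  | a :: x, [], c :: z, h1, h2 => by
    rw [inorderLT_cons_nil] at h1
    rw [inorderLT_nil_cons] at h2
    rw [inorderLT_cons_cons]
    exact Or.inl ⟨h1, h2⟩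
  | a :: x, b :: y, [], h1, h2 => by
    rw [inorderLT_cons_nil] at h2 ⊢
    rw [inorderLT_cons_cons] at h1
    grind
  | a :: x, b :: y, c :: z, h1, h2 => by
    rw [inorderLT_cons_cons] at h1 h2 ⊢
    have := inorderLT_trans x y z
    grind

theorem inorderLT_trichotomous :
    ∀ x y : List Bool, InorderLT x y ∨ x = y ∨ InorderLT y x
  | [], [] => by simp
  | [], b :: y => by
    rw [inorderLT_nil_cons, inorderLT_cons_nil]
    cases b <;> simp
  | a :: x, [] => by
    rw [inorderLT_nil_cons, inorderLT_cons_nil]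
    cases a <;> simp
  | a :: x, b :: y => by
    rw [inorderLT_cons_cons, inorderLT_cons_cons]
    have := inorderLT_trichotomous x y
    cases a <;> cases b <;> simp_all

instance BinWord.isStrictTotalOrder :
    IsStrictTotalOrder BinWord (fun x y : BinWord => InorderLT x y) where
  trichotomous x y h1 h2 := ((inorderLT_trichotomous x y).resolve_left h1).resolve_right h2
  irrefl _ h := h.1 rfl
  trans x y z := inorderLT_trans x y z

/-- Binary words are linearly ordered by the inorder: `x < y` is `InorderLT x y`. -/
noncomputable instance BinWord.instLinearOrder : LinearOrder BinWord := by
  classical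
  exact linearOrderOfSTO (fun x y : BinWord => InorderLT x y)

theorem BinWord.lt_iff (x y : BinWord) : x < y ↔ InorderLT x y := Iff.rfl

/-- The linguage of an automaton over `{0, 1}`: its language with the order induced by the
inorder. -/
abbrev PartialDFA.Linguage {Q : Type*} (M : PartialDFA Bool Q) : Type :=
  {x : BinWord // (x : List Bool) ∈ M.language}

/-! Both directions pass through sets of words with finitely many quotients (`HasFiniteQuotients`),
which by the Myhill–Nerode argument are the languages of automata.

From orders to languages, each construction is imitated on words. A sum prefixes 0 and 1 to its
summands. A product with ω uses the words 1ⁿ0x, one with ω* the words 0ⁿ1x. For a shuffle, colour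
the nodes of the complete binary tree by depth modulo the number of colours. Below both children of
a node every colour occurs, so the colouring is dense for the inorder, and Cantor's theorem for
coloured orders (`IsDenseColoring.exists_orderIso`) identifies the tree with ℚ. `treeSum` hangs a
copy of the right language at each node.

From languages to orders, induct on the number of quotients of S. Let C be the strongly connected
component of S: the quotients of S that have S as a quotient. A quotient of S outside C has fewer
quotients than S, so it is settled by induction. Call a walk inside C branching if both letters
continue it inside C. The branching walks cut a language in C into an initial part, one convex
cluster for each branching walk, and a final part (`Component.position_mono`).

An end part follows a single walk in C, which is eventually periodic because C is finite. The words
leaving one period form a finite description order, and repeating it yields a product with ω or ω*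
(`Component.isFiniteDescription_endPart`). A cluster is put together from two end parts and at most
one further word. Up to isomorphism it depends only on the quotient reached, and strong
connectedness makes the colouring of branching walks by these quotients dense, so the clusters form
a shuffle if there are any (`Component.isFiniteDescription_middle`). -/

/-! ### Dense colourings and Cantor's theorem for coloured orders -/

/-- Every colour occurs between any two points and on both sides of every point. -/
structure IsDenseColoring {α κ : Type*} [LinearOrder α] (c : α → κ) : Prop where
  exists_between : ∀ (k : κ) (x y : α), x < y → ∃ z, x < z ∧ z < y ∧ c z = k
  exists_lt : ∀ (k : κ) (x : α), ∃ z, z < x ∧ c z = k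
  exists_gt : ∀ (k : κ) (x : α), ∃ z, x < z ∧ c z = k

namespace IsDenseColoring

variable {α β κ : Type*} [LinearOrder α] [LinearOrder β] {c : α → κ} {d : β → κ}

theorem exists_between_finsets [Nonempty α] (hc : IsDenseColoring c) (k : κ) (lo hi : Finset α)
    (h : ∀ x ∈ lo, ∀ y ∈ hi, x < y) :
    ∃ m, (∀ x ∈ lo, x < m) ∧ (∀ y ∈ hi, m < y) ∧ c m = k := by
  rcases lo.eq_empty_or_nonempty with rfl | nlo
  · rcases hi.eq_empty_or_nonempty with rfl | nhi
    · obtain ⟨m, -, hm⟩ := hc.exists_lt k (Classical.arbitrary α)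
      exact ⟨m, by simp, by simp, hm⟩
    · obtain ⟨m, hm, hk⟩ := hc.exists_lt k (hi.min' nhi)
      exact ⟨m, by simp, fun y hy => hm.trans_le (Finset.min'_le hi y hy), hk⟩
  · rcases hi.eq_empty_or_nonempty with rfl | nhi
    · obtain ⟨m, hm, hk⟩ := hc.exists_gt k (lo.max' nlo)
      exact ⟨m, fun x hx => (Finset.le_max' lo x hx).trans_lt hm, by simp, hk⟩
    · obtain ⟨m, h1, h2, hk⟩ := hc.exists_between k _ _
        (h _ (Finset.max'_mem lo nlo) _ (Finset.min'_mem hi nhi))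
      exact ⟨m, fun x hx => (Finset.le_max' lo x hx).trans_lt h1,
        fun y hy => h2.trans_le (Finset.min'_le hi y hy), hk⟩

/-- Finite partial isomorphisms that preserve the colours. -/
abbrev PartialIso (c : α → κ) (d : β → κ) : Type _ :=
  {f : Order.PartialIso α β // ∀ p ∈ f.val, c p.1 = d p.2}

/-- The forth step of back-and-forth: density supplies a point of colour `c a` above the partners of
all points below `a` and below the partners of all points above it. -/
theorem exists_extension_left [Nonempty β] (hd : IsDenseColoring d) (f : PartialIso c d) (a : α) :
    ∃ g : PartialIso c d, (∃ b, (a, b) ∈ g.val.val) ∧ f ≤ g := by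
  by_cases h : ∃ b, (a, b) ∈ f.val.val
  · exact ⟨f, h, le_rfl⟩
  obtain ⟨b, hlo, hhi, hk⟩ := hd.exists_between_finsets (c a)
    ({p ∈ f.val.val | p.fst < a}.image Prod.snd) ({p ∈ f.val.val | a < p.fst}.image Prod.snd) (by
      intro x hx y hy
      simp only [Finset.mem_image, Finset.mem_filter] at hx hy
      obtain ⟨p, hp, rfl⟩ := hx
      obtain ⟨q, hq, rfl⟩ := hy
      rw [← lt_iff_lt_of_cmp_eq_cmp (f.val.prop _ hp.1 _ hq.1)]
      exact hp.2.trans hq.2)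
  have hab : ∀ p ∈ f.val.val, cmp p.1 a = cmp p.2 b := by
    intro p hp
    rcases lt_trichotomy p.1 a with hl | rfl | hr
    · rw [cmp_eq_lt_iff _ _ |>.2 hl, eq_comm, cmp_eq_lt_iff]
      exact hlo _ (Finset.mem_image.2 ⟨p, Finset.mem_filter.2 ⟨hp, hl⟩, rfl⟩)
    · exact absurd ⟨p.2, hp⟩ h
    · rw [cmp_eq_gt_iff _ _ |>.2 hr, eq_comm, cmp_eq_gt_iff]
      exact hhi _ (Finset.mem_image.2 ⟨p, Finset.mem_filter.2 ⟨hp, hr⟩, rfl⟩)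
  refine ⟨⟨⟨insert (a, b) f.val.val, ?_⟩, ?_⟩, ⟨b, Finset.mem_insert_self _ _⟩,
    Finset.subset_insert _ _⟩
  · intro p hp q hq
    rcases Finset.mem_insert.1 hp with rfl | hp <;> rcases Finset.mem_insert.1 hq with rfl | hq
    · simp only [cmp_self_eq_eq]
    · rw [cmp_eq_cmp_symm]
      exact hab _ hq
    · exact hab _ hp
    · exact f.val.prop _ hp _ hq
  · intro p hp
    rcases Finset.mem_insert.1 hp with rfl | hp
    · exact hk.symm
    · exact f.prop p hp

theorem mem_comm_iff (f : Order.PartialIso α β) (a : α) (b : β) :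
    (b, a) ∈ f.comm.val ↔ (a, b) ∈ f.val := by
  change (b, a) ∈ f.val.image _ ↔ _
  simp [Equiv.prodComm]

/-- The back step is the forth step for the inverse partial isomorphism. -/
theorem exists_extension_right [Nonempty α] (hc : IsDenseColoring c) (f : PartialIso c d) (b : β) :
    ∃ g : PartialIso c d, (∃ a, (a, b) ∈ g.val.val) ∧ f ≤ g := by
  obtain ⟨g, ⟨a, ha⟩, hfg⟩ := exists_extension_left hc
    (⟨f.val.comm, fun p hp => (f.prop (p.2, p.1) ((mem_comm_iff _ _ _).1 hp)).symm⟩ :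
      PartialIso d c) b
  refine ⟨⟨g.val.comm, fun p hp => (g.prop (p.2, p.1) ((mem_comm_iff _ _ _).1 hp)).symm⟩,
    ⟨a, (mem_comm_iff _ _ _).2 ha⟩, fun p hp => (mem_comm_iff _ _ _).2 ?_⟩
  exact hfg ((mem_comm_iff _ _ _).2 hp)

/-- Cantor's isomorphism theorem for densely coloured countable linear orders. -/
theorem exists_orderIso [Countable α] [Nonempty α] [Countable β] [Nonempty β]
    (hc : IsDenseColoring c) (hd : IsDenseColoring d) :
    ∃ e : α ≃o β, ∀ a, d (e a) = c a := by
  cases nonempty_encodable α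
  cases nonempty_encodable β
  -- Each point of either order gives one cofinal requirement, namely to be matched. There are
  -- countably many, so one ideal containing the empty map meets them all.
  let cof : α ⊕ β → Order.Cofinal (PartialIso c d) := fun p => Sum.recOn p
    (fun a => ⟨{g | ∃ b, (a, b) ∈ g.val.val}, fun f => exists_extension_left hd f a⟩)
    (fun b => ⟨{g | ∃ a, (a, b) ∈ g.val.val}, fun f => exists_extension_right hc f b⟩)
  let I : Order.Ideal (PartialIso c d) := Order.idealOfCofinals
    ⟨default, fun p hp => absurd hp (Finset.notMem_empty p)⟩ cof
  have hF : ∀ a, ∃ b, ∃ f ∈ I, (a, b) ∈ f.val.val := fun a => by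
    obtain ⟨f, ⟨b, hb⟩, hf⟩ := Order.cofinal_meets_idealOfCofinals _ cof (Sum.inl a)
    exact ⟨b, f, hf, hb⟩
  have hG : ∀ b, ∃ a, ∃ f ∈ I, (a, b) ∈ f.val.val := fun b => by
    obtain ⟨f, ⟨a, ha⟩, hf⟩ := Order.cofinal_meets_idealOfCofinals _ cof (Sum.inr b)
    exact ⟨a, f, hf, ha⟩
  choose F hF using hF
  choose G hG using hG
  refine ⟨OrderIso.ofCmpEqCmp F G fun a b => ?_, fun a => ?_⟩
  · obtain ⟨f, hf, ha⟩ := hF a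
    obtain ⟨g, hg, hb⟩ := hG b
    obtain ⟨m, -, fm, gm⟩ := I.directed _ hf _ hg
    exact m.val.prop (a, _) (fm ha) (_, b) (gm hb)
  · obtain ⟨f, -, ha⟩ := hF a
    exact (f.prop _ ha).symm

end IsDenseColoring

theorem IsHomogeneousColoring.isDenseColoring {n : ℕ} {χ : ℚ → Fin n}
    (h : IsHomogeneousColoring χ) : IsDenseColoring χ := by
  have key : ∀ (k : Fin n) (x y : ℚ), x < y → ∃ z, x < z ∧ z < y ∧ χ z = k := fun k x y hxy => by
    obtain ⟨z, hz, h1, h2⟩ := (h k).exists_between hxy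
    exact ⟨z, h1, h2, hz⟩
  refine ⟨key, fun k x => ?_, fun k x => ?_⟩
  · obtain ⟨z, -, h2, hz⟩ := key k (x - 1) x (by linarith)
    exact ⟨z, h2, hz⟩
  · obtain ⟨z, h1, -, hz⟩ := key k x (x + 1) (by linarith)
    exact ⟨z, h1, hz⟩

/-! ### Isomorphisms of lexicographic sums -/

section LexSums

variable {α β γ : Type*} [LinearOrder α] [LinearOrder β] [LinearOrder γ]

theorem nonempty_orderIso_of_strictMono {f : α → β} (hf : StrictMono f)
    (hs : Function.Surjective f) : Nonempty (α ≃o β) :=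
  ⟨hf.orderIsoOfSurjective f hs⟩

/-- A linear order is the sum of two parts that lie one before the other. -/
theorem nonempty_sumLex_orderIso {f : α → γ} {g : β → γ} (hf : StrictMono f) (hg : StrictMono g)
    (hfg : ∀ a b, f a < g b) (hs : ∀ z, (∃ a, f a = z) ∨ ∃ b, g b = z) :
    Nonempty (α ⊕ₗ β ≃o γ) := by
  refine nonempty_orderIso_of_strictMono (f := fun s => Sum.elim f g (ofLex s)) ?_ ?_
  · intro x y h
    change Sum.elim f g (ofLex x) < Sum.elim f g (ofLex y)
    rw [Sum.Lex.lt_def] at h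
    revert h
    generalize ofLex x = x
    generalize ofLex y = y
    rintro (h | h | h)
    · exact hf h
    · exact hg h
    · exact hfg _ _
  · intro z
    rcases hs z with ⟨a, rfl⟩ | ⟨b, rfl⟩
    · exact ⟨toLex (Sum.inl a), rfl⟩
    · exact ⟨toLex (Sum.inr b), rfl⟩

/-- A linear order is the ordered sum of the parts `g i '' X i`. -/
theorem nonempty_sigmaLex_orderIso {X : α → Type*} [∀ i, LinearOrder (X i)] {g : ∀ i, X i → γ}
    (hg : ∀ i, StrictMono (g i)) (hlt : ∀ i j, i < j → ∀ x y, g i x < g j y)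
    (hs : ∀ z, ∃ i x, g i x = z) : Nonempty ((Σₗ i, X i) ≃o γ) := by
  refine nonempty_orderIso_of_strictMono (f := fun s => g (ofLex s).1 (ofLex s).2) ?_ ?_
  · intro x y h
    change Sigma.Lex _ _ (ofLex x) (ofLex y) at h
    change g (ofLex x).1 (ofLex x).2 < g (ofLex y).1 (ofLex y).2
    revert h
    generalize ofLex x = x
    generalize ofLex y = y
    rintro (⟨_, _, h⟩ | ⟨_, _, h⟩)
    · exact hlt _ _ h _ _
    · exact hg _ h
  · intro z
    obtain ⟨i, x, rfl⟩ := hs z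
    exact ⟨toLex ⟨i, x⟩, rfl⟩

theorem nonempty_prodLex_orderIso {f : α → β → γ} (hf : ∀ i, StrictMono (f i))
    (hlt : ∀ i j, i < j → ∀ x y, f i x < f j y) (hs : ∀ z, ∃ i x, f i x = z) :
    Nonempty (α ×ₗ β ≃o γ) := by
  refine nonempty_orderIso_of_strictMono (f := fun s => f (ofLex s).1 (ofLex s).2) ?_ ?_
  · intro x y h
    rcases Prod.Lex.lt_iff.1 h with h | ⟨h, h'⟩
    · exact hlt _ _ h _ _
    · dsimp only
      rw [h]
      exact hf _ h'
  · intro z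
    obtain ⟨i, x, rfl⟩ := hs z
    exact ⟨toLex ⟨i, x⟩, rfl⟩

theorem nonempty_sigmaLex_congr {X : α → Type*} {Y : β → Type*} [∀ i, LinearOrder (X i)]
    [∀ i, LinearOrder (Y i)] (e : α ≃o β) (h : ∀ i, Nonempty (X i ≃o Y (e i))) :
    Nonempty ((Σₗ i, X i) ≃o Σₗ i, Y i) := by
  have F := fun i => (h i).some
  refine nonempty_sigmaLex_orderIso (γ := Σₗ i, Y i) (g := fun i x => toLex ⟨e i, F i x⟩)
    ?_ ?_ ?_
  · intro i x y hxy
    exact Sigma.Lex.right _ _ ((F i).strictMono hxy)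
  · intro i j hij x y
    exact Sigma.Lex.left _ _ (e.strictMono hij)
  · rintro ⟨j, y⟩
    obtain ⟨i, rfl⟩ := e.surjective j
    obtain ⟨x, rfl⟩ := (F i).surjective y
    exact ⟨i, x, rfl⟩

end LexSums

/-! ### Finite description linear orders -/

namespace IsFiniteDescription

/-- The class of finite description orders does not depend on the universe. -/
theorem exists_orderIso {L : Type u} [LinearOrder L] (h : IsFiniteDescription L) :
    ∃ (L' : Type*) (_ : LinearOrder L'), IsFiniteDescription L' ∧ Nonempty (L ≃o L') := by
  induction h with
  | zero => exact ⟨PEmpty, inferInstance, zero, ⟨OrderIso.ofIsEmpty _ _⟩⟩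
  | one => exact ⟨PUnit, inferInstance, one, ⟨OrderIso.ofUnique _ _⟩⟩
  | add L₀ L₁ _ _ ih₀ ih₁ =>
    obtain ⟨M₀, _, h₀, ⟨e₀⟩⟩ := ih₀
    obtain ⟨M₁, _, h₁, ⟨e₁⟩⟩ := ih₁
    exact ⟨M₀ ⊕ₗ M₁, inferInstance, add _ _ h₀ h₁, ⟨OrderIso.sumLexCongr e₀ e₁⟩⟩
  | mul_omega L _ ih =>
    obtain ⟨M, _, h, ⟨e⟩⟩ := ih
    exact ⟨ℕ ×ₗ M, inferInstance, mul_omega _ h, ⟨Prod.Lex.prodLexCongr (.refl _) e⟩⟩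
  | mul_omega_star L _ ih =>
    obtain ⟨M, _, h, ⟨e⟩⟩ := ih
    exact ⟨ℕᵒᵈ ×ₗ M, inferInstance, mul_omega_star _ h, ⟨Prod.Lex.prodLexCongr (.refl _) e⟩⟩
  | shuffle n L χ hχ _ ih =>
    choose M _ h e using ih
    exact ⟨Σₗ r : ℚ, M (χ r), inferInstance, shuffle n M χ hχ h,
      nonempty_sigmaLex_congr (OrderIso.refl ℚ) fun r => e (χ r)⟩
  | iso L L' e _ ih =>
    obtain ⟨M, _, h, ⟨e'⟩⟩ := ih
    exact ⟨M, inferInstance, h, ⟨e.symm.trans e'⟩⟩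

theorem of_isEmpty (L : Type u) [LinearOrder L] [IsEmpty L] : IsFiniteDescription L :=
  iso _ _ (OrderIso.ofIsEmpty PEmpty.{u + 1} L) zero

theorem of_subsingleton (L : Type u) [LinearOrder L] [Subsingleton L] :
    IsFiniteDescription L := by
  cases isEmpty_or_nonempty L
  · exact of_isEmpty L
  · inhabit L
    have : Unique L := Unique.mk' L
    exact iso _ _ (OrderIso.ofUnique PUnit.{u + 1} L) one

/-- A sum along a countable order with a dense colouring is a shuffle. -/
theorem of_isDenseColoring {D κ : Type*} [LinearOrder D] [Countable D] [Nonempty D] [Finite κ]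
    {c : D → κ} (hc : IsDenseColoring c) {X : κ → Type u} [∀ k, LinearOrder (X k)]
    (hX : ∀ k, IsFiniteDescription (X k)) {L : Type u} [LinearOrder L] {f : L → D}
    (hf : Monotone f) (h : ∀ d, Nonempty (X (c d) ≃o {x // f x = d})) : IsFiniteDescription L := by
  obtain ⟨n, ⟨ε⟩⟩ := Finite.exists_equiv_fin κ
  let k₀ := c (Classical.arbitrary D)
  have : DenselyOrdered D :=
    ⟨fun x y hxy => let ⟨z, h1, h2, _⟩ := hc.exists_between k₀ x y hxy; ⟨z, h1, h2⟩⟩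
  have : NoMinOrder D := ⟨fun x => let ⟨z, h1, _⟩ := hc.exists_lt k₀ x; ⟨z, h1⟩⟩
  have : NoMaxOrder D := ⟨fun x => let ⟨z, h1, _⟩ := hc.exists_gt k₀ x; ⟨z, h1⟩⟩
  -- The uncoloured Cantor theorem suffices here: the colouring is carried over to ℚ along `e`, and
  -- a shuffle admits any homogeneous colouring.
  obtain ⟨e⟩ := Order.iso_of_countable_dense ℚ D
  have hχ : IsHomogeneousColoring fun r => ε (c (e r)) := by
    refine fun k => dense_of_exists_between fun x y hxy => ?_
    obtain ⟨z, h1, h2, hz⟩ := hc.exists_between (ε.symm k) (e x) (e y) (e.strictMono hxy)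
    refine ⟨e.symm z, by simp [hz], ?_, ?_⟩
    · rwa [e.lt_symm_apply]
    · rwa [e.symm_apply_lt]
  have hS := shuffle n (fun k => X (ε.symm k)) _ hχ fun k => hX _
  have he : ∀ r, Nonempty (X (ε.symm (ε (c (e r)))) ≃o {x // f x = e r}) := fun r => by
    rw [ε.symm_apply_apply]
    exact h _
  have F := fun r => (he r).some
  obtain ⟨i⟩ : Nonempty ((Σₗ r : ℚ, X (ε.symm (ε (c (e r))))) ≃o L) := by
    refine nonempty_sigmaLex_orderIso (g := fun r x => (F r x).val) ?_ ?_ ?_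
    · exact fun r x y hxy => (F r).strictMono hxy
    · intro r s hrs x y
      refine hf.reflect_lt ?_
      rw [(F r x).prop, (F s y).prop]
      exact e.strictMono hrs
    · intro z
      obtain ⟨r, hr⟩ := e.surjective (f z)
      obtain ⟨x, hx⟩ := (F r).surjective ⟨z, hr.symm⟩
      exact ⟨r, x, by rw [hx]⟩
  exact iso _ _ i hS

end IsFiniteDescription

/-! ### Sets of binary words ordered by the inorder -/

theorem inorderLT_cons_iff (a : Bool) (x y : List Bool) :
    InorderLT (a :: x) (a :: y) ↔ InorderLT x y := by
  rw [inorderLT_cons_cons]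
  cases a <;> simp

theorem inorderLT_append_iff (v x y : List Bool) :
    InorderLT (v ++ x) (v ++ y) ↔ InorderLT x y := by
  induction v with
  | nil => rfl
  | cons a v ih => rw [List.cons_append, List.cons_append, inorderLT_cons_iff, ih]

/-- A set of words with the inorder. -/
abbrev WordOrder (S : Set (List Bool)) : Type := {x : BinWord // (x : List Bool) ∈ S}

namespace WordOrder

/-- Strictly monotone maps into words with image `S` are isomorphisms onto `S`. -/
theorem nonempty_orderIso_image {S T : Set (List Bool)} (g : List Bool → List Bool)
    (hg : ∀ x y, InorderLT x y → InorderLT (g x) (g y)) (hS : g '' T = S) :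
    Nonempty (WordOrder T ≃o WordOrder S) := by
  subst hS
  refine nonempty_orderIso_of_strictMono
    (f := fun x : WordOrder T => (⟨g x.1, x.1, x.2, rfl⟩ : WordOrder (g '' T))) ?_ ?_
  · exact fun x y h => hg _ _ h
  · rintro ⟨_, x, hx, rfl⟩
    exact ⟨⟨x, hx⟩, rfl⟩

theorem nonempty_orderIso_cons {S T : Set (List Bool)} (a : Bool) (h : List.cons a '' T = S) :
    Nonempty (WordOrder T ≃o WordOrder S) :=
  nonempty_orderIso_image (List.cons a) (fun x y => (inorderLT_cons_iff a x y).2) h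

theorem nonempty_sumLex_orderIso_union {S A B : Set (List Bool)} (hS : A ∪ B = S)
    (hlt : ∀ x ∈ A, ∀ y ∈ B, InorderLT x y) :
    Nonempty (WordOrder A ⊕ₗ WordOrder B ≃o WordOrder S) := by
  subst hS
  refine nonempty_sumLex_orderIso
    (f := fun x : WordOrder A => (⟨x.1, Or.inl x.2⟩ : WordOrder (A ∪ B)))
    (g := fun x : WordOrder B => (⟨x.1, Or.inr x.2⟩ : WordOrder (A ∪ B))) ?_ ?_ ?_ ?_
  · exact fun x y h => h
  · exact fun x y h => h
  · exact fun x y => hlt _ x.2 _ y.2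
  · rintro ⟨x, hx | hx⟩
    · exact Or.inl ⟨⟨x, hx⟩, rfl⟩
    · exact Or.inr ⟨⟨x, hx⟩, rfl⟩

/-- The words of `S` that do not begin with `v`. -/
def noPrefix (S : Set (List Bool)) (v : List Bool) : Set (List Bool) :=
  {w | w ∈ S ∧ ¬ v <+: w}

theorem iterate_append_mem {S : Set (List Bool)} {v : List Bool}
    (hS : ∀ w, v ++ w ∈ S ↔ w ∈ S) (n : ℕ) (w : List Bool) :
    (v ++ ·)^[n] w ∈ S ↔ w ∈ S := by
  induction n with
  | zero => rfl
  | succ n ih => rw [Function.iterate_succ_apply', hS, ih]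

theorem inorderLT_iterate_append_iff (v : List Bool) (n : ℕ) (x y : List Bool) :
    InorderLT ((v ++ ·)^[n] x) ((v ++ ·)^[n] y) ↔ InorderLT x y := by
  induction n with
  | zero => rfl
  | succ n ih => simp only [Function.iterate_succ_apply', inorderLT_append_iff, ih]

theorem iterate_append_add_succ (v : List Bool) (i k : ℕ) (w : List Bool) :
    (v ++ ·)^[i + k + 1] w = (v ++ ·)^[i] (v ++ (v ++ ·)^[k] w) := by
  rw [add_assoc, Function.iterate_add_apply, Function.iterate_succ_apply']

/-- Cancelling the common prefix `vⁱ` reduces the comparison of two copies to that of copy 0 with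
copy `k + 1`. -/
theorem inorderLT_iterate_append_add_succ {v x y : List Bool} {k : ℕ} (i : ℕ)
    (h : InorderLT x (v ++ (v ++ ·)^[k] y)) :
    InorderLT ((v ++ ·)^[i] x) ((v ++ ·)^[i + k + 1] y) := by
  rwa [iterate_append_add_succ, inorderLT_iterate_append_iff]

theorem iterate_append_add_succ_inorderLT {v x y : List Bool} {k : ℕ} (i : ℕ)
    (h : InorderLT (v ++ (v ++ ·)^[k] x) y) :
    InorderLT ((v ++ ·)^[i + k + 1] x) ((v ++ ·)^[i] y) := by
  rwa [iterate_append_add_succ, inorderLT_iterate_append_iff]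

/-- Strip `v` from the front as long as possible; this stops because `v` is nonempty and the length
drops. -/
theorem exists_iterate_append {S : Set (List Bool)} {v : List Bool} (hv : v ≠ [])
    (hS : ∀ w, v ++ w ∈ S ↔ w ∈ S) (w : List Bool) (hw : w ∈ S) :
    ∃ n, ∃ x ∈ noPrefix S v, (v ++ ·)^[n] x = w := by
  induction hl : w.length using Nat.strong_induction_on generalizing w with | _ l ih
  by_cases h : v <+: w
  · obtain ⟨w, rfl⟩ := h
    have : 0 < v.length := List.length_pos_of_ne_nil hv
    obtain ⟨n, x, hx, rfl⟩ := ih w.length (by simp at hl; omega) w ((hS w).1 hw) rfl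
    exact ⟨n + 1, x, hx, Function.iterate_succ_apply' _ _ _⟩
  · exact ⟨0, w, ⟨hw, h⟩, rfl⟩

/-- If `S` is invariant under prefixing `v` and its other words come first, then `S` is the
product of those words with `ω`. -/
theorem nonempty_prodLex_nat_orderIso {S : Set (List Bool)} {v : List Bool} (hv : v ≠ [])
    (hS : ∀ w, v ++ w ∈ S ↔ w ∈ S)
    (hlt : ∀ x ∈ noPrefix S v, ∀ y ∈ S, InorderLT x (v ++ y)) :
    Nonempty (ℕ ×ₗ WordOrder (noPrefix S v) ≃o WordOrder S) := by
  refine nonempty_prodLex_orderIso (f := fun n (x : WordOrder (noPrefix S v)) =>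
    (⟨(v ++ ·)^[n] x.1, (iterate_append_mem hS n _).2 x.2.1⟩ : WordOrder S)) ?_ ?_ ?_
  · exact fun n x y h => (inorderLT_iterate_append_iff v n _ _).2 h
  · intro i j hij x y
    obtain ⟨k, rfl⟩ := Nat.exists_eq_add_of_lt hij
    exact inorderLT_iterate_append_add_succ i (hlt _ x.2 _ ((iterate_append_mem hS k _).2 y.2.1))
  · rintro ⟨w, hw⟩
    obtain ⟨n, x, hx, rfl⟩ := exists_iterate_append hv hS w hw
    exact ⟨n, ⟨x, hx⟩, rfl⟩

/-- If `S` is invariant under prefixing `v` and its other words come last, then `S` is the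
product of those words with `ω*`. -/
theorem nonempty_prodLex_natDual_orderIso {S : Set (List Bool)} {v : List Bool} (hv : v ≠ [])
    (hS : ∀ w, v ++ w ∈ S ↔ w ∈ S)
    (hlt : ∀ x ∈ noPrefix S v, ∀ y ∈ S, InorderLT (v ++ y) x) :
    Nonempty (ℕᵒᵈ ×ₗ WordOrder (noPrefix S v) ≃o WordOrder S) := by
  refine nonempty_prodLex_orderIso (f := fun (n : ℕᵒᵈ) (x : WordOrder (noPrefix S v)) =>
    (⟨(v ++ ·)^[OrderDual.ofDual n] x.1, (iterate_append_mem hS _ _).2 x.2.1⟩ : WordOrder S))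
    ?_ ?_ ?_
  · exact fun n x y h => (inorderLT_iterate_append_iff v _ _ _).2 h
  · intro i j hij x y
    obtain ⟨k, hk⟩ := Nat.exists_eq_add_of_lt (OrderDual.ofDual_lt_ofDual.2 hij)
    have := iterate_append_add_succ_inorderLT (OrderDual.ofDual j)
      (hlt _ y.2 _ ((iterate_append_mem hS k _).2 x.2.1))
    rw [← hk] at this
    exact this
  · rintro ⟨w, hw⟩
    obtain ⟨n, x, hx, rfl⟩ := exists_iterate_append hv hS w hw
    exact ⟨OrderDual.toDual n, ⟨x, hx⟩, rfl⟩

end WordOrder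

/-! ### Quotients and regular languages -/

/-- The words that can be read after the letter `a`. -/
def letterQuotient (a : Bool) (S : Set (List Bool)) : Set (List Bool) := {w | a :: w ∈ S}

@[simp] theorem mem_letterQuotient {a : Bool} {S : Set (List Bool)} {w : List Bool} :
    w ∈ letterQuotient a S ↔ a :: w ∈ S := Iff.rfl

/-- A set of words is regular if it belongs to a finite family closed under quotients by letters. -/
def HasFiniteQuotients (S : Set (List Bool)) : Prop :=
  ∃ F : Set (Set (List Bool)), F.Finite ∧ S ∈ F ∧ ∀ T ∈ F, ∀ a, letterQuotient a T ∈ F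

/-- The members of the finite family serve as states, reading a letter takes the quotient, and a
state accepts if it contains the empty word. -/
theorem HasFiniteQuotients.exists_partialDFA {S : Set (List Bool)} (h : HasFiniteQuotients S) :
    ∃ (Q : Type) (_ : Finite Q) (M : PartialDFA Bool Q), M.language = S := by
  obtain ⟨F, hF, hS, hres⟩ := h
  let M : PartialDFA Bool F :=
    { step := fun T a => some ⟨letterQuotient a T.1, hres _ T.2 a⟩
      start := ⟨S, hS⟩
      accept := {T | [] ∈ T.1} }
  have key : ∀ (w : List Bool) (T : F), (∃ q ∈ M.accept, M.evalFrom T w = some q) ↔ w ∈ T.1 := by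
    intro w
    induction w with
    | nil =>
      intro T
      simp [PartialDFA.evalFrom, M]
    | cons a w ih => exact fun T => ih ⟨letterQuotient a T.1, hres _ T.2 a⟩
  exact ⟨F, hF, M, Set.ext fun w => key w ⟨S, hS⟩⟩

/-- The family consists of the languages accepted from the single states, together with `∅` for
undefined transitions. -/
theorem PartialDFA.hasFiniteQuotients_language {Q : Type*} [Finite Q] (M : PartialDFA Bool Q) :
    HasFiniteQuotients M.language := by
  let lang : Q → Set (List Bool) := fun q => {w | ∃ p ∈ M.accept, M.evalFrom q w = some p}
  refine ⟨insert ∅ (Set.range lang), (Set.finite_range lang).insert _,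
    Or.inr ⟨M.start, rfl⟩, ?_⟩
  rintro T (rfl | ⟨q, rfl⟩) a
  · exact Or.inl rfl
  · cases h : M.step q a with
    | none =>
      left
      ext w
      simp [lang, PartialDFA.evalFrom, h]
    | some p =>
      right
      refine ⟨p, ?_⟩
      ext w
      simp [lang, PartialDFA.evalFrom, h]

/-- A set of words with prescribed quotients by letters. -/
def branch (A : Bool → Set (List Bool)) : Set (List Bool) :=
  {w | ∃ a, ∃ x ∈ A a, w = a :: x}

@[simp] theorem letterQuotient_branch (A : Bool → Set (List Bool)) (a : Bool) :
    letterQuotient a (branch A) = A a := by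
  ext w
  cases a <;> simp [branch]

namespace IsFiniteDescription

theorem wordOrder_union {S A B : Set (List Bool)} (hS : A ∪ B = S)
    (hlt : ∀ x ∈ A, ∀ y ∈ B, InorderLT x y) (hA : IsFiniteDescription (WordOrder A))
    (hB : IsFiniteDescription (WordOrder B)) : IsFiniteDescription (WordOrder S) :=
  let ⟨e⟩ := WordOrder.nonempty_sumLex_orderIso_union hS hlt
  iso _ _ e (add _ _ hA hB)

theorem wordOrder_of_subsingleton {S : Set (List Bool)} (hS : S.Subsingleton) :
    IsFiniteDescription (WordOrder S) := by
  have : Subsingleton (WordOrder S) := ⟨fun x y => Subtype.ext (hS x.2 y.2)⟩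
  exact of_subsingleton _

/-- In the inorder the words beginning with 0 precede the empty word, which precedes those beginning
with 1; hence `S` is a sum of three orders. -/
theorem wordOrder_of_letterQuotient {S : Set (List Bool)}
    (h : ∀ a, IsFiniteDescription (WordOrder (letterQuotient a S))) :
    IsFiniteDescription (WordOrder S) := by
  have hc : ∀ a, IsFiniteDescription (WordOrder (List.cons a '' letterQuotient a S)) := fun a =>
    let ⟨e⟩ := WordOrder.nonempty_orderIso_cons a rfl
    iso _ _ e (h a)
  have he : IsFiniteDescription (WordOrder {w | w ∈ S ∧ w = []}) :=
    wordOrder_of_subsingleton fun x hx y hy => hx.2.trans hy.2.symm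
  refine wordOrder_union ?_ ?_ (hc false) (wordOrder_union rfl ?_ he (hc true))
  · ext w
    rcases w with _ | ⟨_ | _, w⟩ <;> simp
  · rintro _ ⟨x, -, rfl⟩ _ (⟨-, rfl⟩ | ⟨y, -, rfl⟩)
    · simp [inorderLT_cons_nil]
    · simp [inorderLT_cons_cons]
  · rintro _ ⟨-, rfl⟩ _ ⟨y, -, rfl⟩
    simp [inorderLT_nil_cons]

end IsFiniteDescription

/-! ### Regular languages for the constructions of finite description orders -/

namespace HasFiniteQuotients

theorem empty : HasFiniteQuotients ∅ :=
  ⟨{∅}, Set.finite_singleton _, rfl, by rintro _ rfl a; rfl⟩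

theorem singleton_nil : HasFiniteQuotients {[]} := by
  refine ⟨{{[]}, ∅}, Set.toFinite _, Or.inl rfl, ?_⟩
  rintro _ (rfl | rfl) a
  · right
    ext w
    simp
  · exact Or.inr rfl

theorem branch {A : Bool → Set (List Bool)} (h : ∀ a, HasFiniteQuotients (A a)) :
    HasFiniteQuotients (branch A) := by
  choose F hF hA hcl using h
  refine ⟨insert (_root_.branch A) (⋃ a, F a), (Set.finite_iUnion hF).insert _, Or.inl rfl, ?_⟩
  rintro T (rfl | hT) a
  · rw [letterQuotient_branch]
    exact Or.inr (Set.mem_iUnion.2 ⟨a, hA a⟩)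
  · obtain ⟨b, hb⟩ := Set.mem_iUnion.1 hT
    exact Or.inr (Set.mem_iUnion.2 ⟨b, hcl b _ hb a⟩)

end HasFiniteQuotients

namespace WordOrder

theorem nonempty_sumLex_orderIso_branch (A : Bool → Set (List Bool)) :
    Nonempty (WordOrder (A false) ⊕ₗ WordOrder (A true) ≃o WordOrder (branch A)) := by
  obtain ⟨e₀⟩ := nonempty_orderIso_cons (T := A false) false rfl
  obtain ⟨e₁⟩ := nonempty_orderIso_cons (T := A true) true rfl
  obtain ⟨e⟩ := nonempty_sumLex_orderIso_union (S := branch A)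
    (A := List.cons false '' A false) (B := List.cons true '' A true) (by
      ext w
      rcases w with _ | ⟨_ | _, w⟩ <;> simp [branch]) (by
      rintro _ ⟨x, -, rfl⟩ _ ⟨y, -, rfl⟩
      simp [inorderLT_cons_cons])
  exact ⟨(OrderIso.sumLexCongr e₀ e₁).trans e⟩

end WordOrder

/-- The words `bⁿ a x` with `a ≠ b` and `x ∈ A`. -/
def loopThen (b : Bool) (A : Set (List Bool)) : List Bool → Prop
  | [] => False
  | a :: w => if a = b then loopThen b A w else w ∈ A

theorem HasFiniteQuotients.loopThen {A : Set (List Bool)} (h : HasFiniteQuotients A) (b : Bool) :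
    HasFiniteQuotients ({w | loopThen b A w}) := by
  obtain ⟨F, hF, hA, hcl⟩ := h
  refine ⟨insert ({w | _root_.loopThen b A w}) F, hF.insert _, Or.inl rfl, ?_⟩
  rintro T (rfl | hT) a
  · by_cases hab : a = b
    · left
      ext w
      simp [_root_.loopThen, hab]
    · right
      convert hA
      ext w
      simp [_root_.loopThen, hab]
  · exact Or.inr (hcl _ hT a)

namespace WordOrder

theorem nonempty_orderIso_noPrefix_loopThen (b : Bool) (A : Set (List Bool)) :
    Nonempty (WordOrder A ≃o WordOrder (noPrefix ({w | loopThen b A w}) [b])) := by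
  refine nonempty_orderIso_cons (!b) ?_
  ext w
  rcases w with _ | ⟨a, w⟩
  · simp [noPrefix, loopThen]
  · cases a <;> cases b <;> simp [noPrefix, loopThen]

theorem exists_cons_of_mem_noPrefix_loopThen {b : Bool} {A : Set (List Bool)} {w : List Bool}
    (h : w ∈ noPrefix ({w | loopThen b A w}) [b]) : ∃ x, w = (!b) :: x := by
  rcases w with _ | ⟨a, w⟩
  · exact h.1.elim
  · obtain ⟨-, h⟩ := h
    exact ⟨w, by cases a <;> cases b <;> simp_all⟩

/-- At the first place where they differ, a word with fewer leading 1s has 0 and one with more has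
1, so the copies increase with the exponent. -/
theorem nonempty_prodLex_nat_orderIso_loopThen (A : Set (List Bool)) :
    Nonempty (ℕ ×ₗ WordOrder A ≃o WordOrder ({w | loopThen true A w})) := by
  obtain ⟨e⟩ := nonempty_orderIso_noPrefix_loopThen true A
  obtain ⟨e'⟩ := nonempty_prodLex_nat_orderIso (S := {w | loopThen true A w}) (v := [true])
    (by simp) (by simp [loopThen]) (by
      rintro x hx y -
      obtain ⟨x, rfl⟩ := exists_cons_of_mem_noPrefix_loopThen hx
      simp [inorderLT_cons_cons])
  exact ⟨(Prod.Lex.prodLexCongr (.refl _) e).trans e'⟩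

theorem nonempty_prodLex_natDual_orderIso_loopThen (A : Set (List Bool)) :
    Nonempty (ℕᵒᵈ ×ₗ WordOrder A ≃o WordOrder ({w | loopThen false A w})) := by
  obtain ⟨e⟩ := nonempty_orderIso_noPrefix_loopThen false A
  obtain ⟨e'⟩ := nonempty_prodLex_natDual_orderIso (S := {w | loopThen false A w}) (v := [false])
    (by simp) (by simp [loopThen]) (by
      rintro x hx y -
      obtain ⟨x, rfl⟩ := exists_cons_of_mem_noPrefix_loopThen hx
      simp [inorderLT_cons_cons])
  exact ⟨(Prod.Lex.prodLexCongr (.refl _) e).trans e'⟩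

end WordOrder

/-! ### Regular languages for shuffles -/

section Shuffle

variable {n : ℕ} (A : Fin (n + 1) → Set (List Bool))

/-- The language of the complete binary tree whose nodes of depth `d` carry copies of
`A (k + d)`: it satisfies `S k = 0 (S (k + 1)) ∪ 1 0 (A k) ∪ 1 1 (S (k + 1))`. -/
def treeSum : Fin (n + 1) → List Bool → Prop
  | _, [] => False
  | k, false :: w => treeSum (k + 1) w
  | _, [true] => False
  | k, true :: false :: w => w ∈ A k
  | k, true :: true :: w => treeSum (k + 1) w

/-- The colour of the node `u` in the tree whose root has colour `k`. -/
def depthColor : Fin (n + 1) → List Bool → Fin (n + 1)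
  | k, [] => k
  | k, _ :: u => depthColor (k + 1) u

theorem depthColor_append (k : Fin (n + 1)) (u v : List Bool) :
    depthColor k (u ++ v) = depthColor (depthColor k u) v := by
  induction u generalizing k with
  | nil => rfl
  | cons a u ih => exact ih (k + 1)

theorem depthColor_replicate (k : Fin (n + 1)) (m : ℕ) (a : Bool) :
    depthColor k (List.replicate m a) = k + m • 1 := by
  induction m generalizing k with
  | zero => simp [depthColor]
  | succ m ih => rw [List.replicate_succ, depthColor, ih, succ_nsmul', add_assoc]

/-- Each letter raises the colour by 1, and 1 generates the cyclic group of colours. -/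
theorem exists_depthColor_replicate (k l : Fin (n + 1)) (a : Bool) :
    ∃ m, depthColor k (List.replicate m a) = l := by
  refine ⟨(l - k).val, ?_⟩
  rw [depthColor_replicate]
  -- `Fin (n + 1)` is by definition `ZMod (n + 1)`, so the cast lemma for residues applies.
  have : (l - k).val • (1 : Fin (n + 1)) = l - k := by
    have := ZMod.natCast_zmod_val (n := n + 1) (l - k)
    rw [← nsmul_one] at this
    exact this
  rw [this, add_sub_cancel]

/-- The word of `treeSum` for the point `x` of the copy at the node `u`. -/
def treeWord (x : List Bool) : List Bool → List Bool
  | [] => true :: false :: x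
  | false :: u => false :: treeWord x u
  | true :: u => true :: true :: treeWord x u

/-- Besides the quotients of the `A k`, only the tree languages and their quotients by a single 1
are needed: after that 1, the next letter decides between entering `A k` and descending. -/
theorem HasFiniteQuotients.treeSum {A : Fin (n + 1) → Set (List Bool)}
    (h : ∀ k, HasFiniteQuotients (A k)) (k : Fin (n + 1)) :
    HasFiniteQuotients ({w | treeSum A k w}) := by
  choose F hF hA hcl using h
  refine ⟨Set.range (fun k => {w | _root_.treeSum A k w}) ∪
    Set.range (fun k => letterQuotient true {w | _root_.treeSum A k w}) ∪ ⋃ k, F k,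
    ((Set.finite_range _).union (Set.finite_range _)).union (Set.finite_iUnion hF),
    Or.inl (Or.inl ⟨k, rfl⟩), ?_⟩
  rintro T ((⟨k, rfl⟩ | ⟨k, rfl⟩) | hT) a
  · cases a
    · refine Or.inl (Or.inl ⟨k + 1, ?_⟩)
      ext w
      simp [_root_.treeSum]
    · exact Or.inl (Or.inr ⟨k, rfl⟩)
  · cases a
    · refine Or.inr (Set.mem_iUnion.2 ⟨k, ?_⟩)
      convert hA k
      ext w
      simp [_root_.treeSum]
    · refine Or.inl (Or.inl ⟨k + 1, ?_⟩)
      ext w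
      simp [_root_.treeSum]
  · obtain ⟨k, hk⟩ := Set.mem_iUnion.1 hT
    exact Or.inr (Set.mem_iUnion.2 ⟨k, hcl k _ hk a⟩)

variable {A}

theorem treeSum_treeWord {k : Fin (n + 1)} {x u : List Bool}
    (hx : x ∈ A (depthColor k u)) : treeSum A k (treeWord x u) := by
  induction u generalizing k with
  | nil => simpa [treeWord, treeSum, depthColor] using hx
  | cons a u ih =>
    have : treeSum A (k + 1) (treeWord x u) := ih hx
    cases a <;> simpa [treeWord, treeSum] using this

theorem exists_treeWord_eq (k : Fin (n + 1)) (w : List Bool) (h : treeSum A k w) :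
    ∃ u x, x ∈ A (depthColor k u) ∧ treeWord x u = w := by
  match w, h with
  | false :: w, h =>
    obtain ⟨u, x, hx, hw⟩ := exists_treeWord_eq (k + 1) w h
    exact ⟨false :: u, x, hx, by simp [treeWord, hw]⟩
  | true :: false :: w, h => exact ⟨[], w, h, rfl⟩
  | true :: true :: w, h =>
    obtain ⟨u, x, hx, hw⟩ := exists_treeWord_eq (k + 1) w h
    exact ⟨true :: u, x, hx, by simp [treeWord, hw]⟩

theorem treeWord_inorderLT_treeWord {x y : List Bool} (h : InorderLT x y) (u : List Bool) :
    InorderLT (treeWord x u) (treeWord y u) := by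
  induction u with
  | nil => simpa [treeWord, inorderLT_cons_iff] using h
  | cons a u ih => cases a <;> simpa [treeWord, inorderLT_cons_iff] using ih

/-- The copy at a node has the code 10, which lies between the codes 0 and 11 of the two subtrees.
-/
theorem treeWord_inorderLT_of_inorderLT (x y : List Bool) :
    ∀ u v, InorderLT u v → InorderLT (treeWord x u) (treeWord y v)
  | [], [], h => absurd h not_inorderLT_nil_nil
  | [], b :: v, h => by
    rw [inorderLT_nil_cons] at h
    simp [h, treeWord, inorderLT_cons_cons]
  | a :: u, [], h => by
    rw [inorderLT_cons_nil] at h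
    simp [h, treeWord, inorderLT_cons_cons]
  | a :: u, b :: v, h => by
    have := treeWord_inorderLT_of_inorderLT x y u v
    rw [inorderLT_cons_cons] at h
    cases a <;> cases b <;> simp_all [treeWord, inorderLT_cons_cons]

theorem WordOrder.nonempty_sigmaLex_orderIso_treeSum (k : Fin (n + 1)) :
    Nonempty ((Σₗ u : BinWord, WordOrder (A (depthColor k u))) ≃o
      WordOrder ({w | treeSum A k w})) := by
  refine nonempty_sigmaLex_orderIso (g := fun (u : BinWord)
    (x : WordOrder (A (depthColor k u))) =>
    (⟨treeWord x.1 u, treeSum_treeWord x.2⟩ : WordOrder ({w | treeSum A k w}))) ?_ ?_ ?_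
  · exact fun u x y h => treeWord_inorderLT_treeWord h u
  · exact fun u v h x y => treeWord_inorderLT_of_inorderLT _ _ _ _ h
  · rintro ⟨w, hw⟩
    obtain ⟨u, x, hx, rfl⟩ := exists_treeWord_eq k w hw
    exact ⟨u, ⟨x, hx⟩, rfl⟩

end Shuffle

/-! ### Density of the inorder -/

theorem inorderLT_append_true_cons (x v : List Bool) : InorderLT x (x ++ true :: v) := by
  have := (inorderLT_append_iff x [] (true :: v)).2 ((inorderLT_nil_cons _ _).2 rfl)
  rwa [List.append_nil] at this

theorem append_false_cons_inorderLT (x v : List Bool) : InorderLT (x ++ false :: v) x := by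
  have := (inorderLT_append_iff x (false :: v) []).2 ((inorderLT_cons_nil _ _).2 rfl)
  rwa [List.append_nil] at this

/-- Between `x < y` there are all extensions of `x1` or all extensions of `y0`. -/
theorem inorderLT_exists_between : ∀ x y : List Bool, InorderLT x y →
    (∀ v, InorderLT (x ++ true :: v) y) ∨ ∀ v, InorderLT x (y ++ false :: v)
  | [], [], h => absurd h not_inorderLT_nil_nil
  | [], b :: y, h => by
    right
    rw [inorderLT_nil_cons] at h
    simp [h, inorderLT_nil_cons]
  | a :: x, [], h => by
    left
    rw [inorderLT_cons_nil] at h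
    simp [h, inorderLT_cons_nil]
  | a :: x, b :: y, h => by
    have := inorderLT_exists_between x y
    rw [inorderLT_cons_cons] at h
    simp only [List.cons_append, inorderLT_cons_cons]
    grind

/-- A colouring of a set of words is dense if all colours occur below both children of every
word. -/
theorem WordOrder.isDenseColoring {S : Set (List Bool)} {κ : Type*} {c : WordOrder S → κ}
    (h : ∀ (k : κ) (x : List Bool), x ∈ S → ∀ a : Bool, ∃ (v : List Bool) (hv : x ++ a :: v ∈ S),
      c ⟨x ++ a :: v, hv⟩ = k) : IsDenseColoring c where
  exists_between k x y hxy := by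
    rcases inorderLT_exists_between x.1 y.1 hxy with hl | hr
    · obtain ⟨v, hv, hk⟩ := h k x.1 x.2 true
      exact ⟨_, inorderLT_append_true_cons x.1 v, hl v, hk⟩
    · obtain ⟨v, hv, hk⟩ := h k y.1 y.2 false
      exact ⟨_, hr v, append_false_cons_inorderLT y.1 v, hk⟩
  exists_lt k x := by
    obtain ⟨v, hv, hk⟩ := h k x.1 x.2 false
    exact ⟨_, append_false_cons_inorderLT x.1 v, hk⟩
  exists_gt k x := by
    obtain ⟨v, hv, hk⟩ := h k x.1 x.2 true
    exact ⟨_, inorderLT_append_true_cons x.1 v, hk⟩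

instance : Countable BinWord := inferInstanceAs (Countable (List Bool))

instance : Nonempty BinWord := ⟨([] : List Bool)⟩

/-- From either child of a node, repeating one letter runs through all colours. -/
theorem BinWord.isDenseColoring_depthColor {n : ℕ} (k₀ : Fin (n + 1)) :
    IsDenseColoring fun u : BinWord => depthColor k₀ u := by
  have h : IsDenseColoring fun u : WordOrder Set.univ => depthColor k₀ u.1 := by
    refine WordOrder.isDenseColoring fun k x _ a => ?_
    obtain ⟨m, hm⟩ := exists_depthColor_replicate (depthColor (depthColor k₀ x) [a]) k a
    rw [← depthColor_append, ← depthColor_append] at hm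
    exact ⟨List.replicate m a, trivial, hm⟩
  refine ⟨fun k x y hxy => ?_, fun k x => ?_, fun k x => ?_⟩
  · obtain ⟨z, h1, h2, h3⟩ := h.exists_between k ⟨x, trivial⟩ ⟨y, trivial⟩ hxy
    exact ⟨z.1, h1, h2, h3⟩
  · obtain ⟨z, h1, h2⟩ := h.exists_lt k ⟨x, trivial⟩
    exact ⟨z.1, h1, h2⟩
  · obtain ⟨z, h1, h2⟩ := h.exists_gt k ⟨x, trivial⟩
    exact ⟨z.1, h1, h2⟩

/-- Every finite description order is isomorphic to a regular language. -/
theorem IsFiniteDescription.exists_wordOrder {L : Type u} [LinearOrder L]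
    (h : IsFiniteDescription L) :
    ∃ S, HasFiniteQuotients S ∧ Nonempty (L ≃o WordOrder S) := by
  induction h with
  | zero =>
    have : IsEmpty (WordOrder ∅) := ⟨fun x => x.2⟩
    exact ⟨∅, .empty, ⟨OrderIso.ofIsEmpty _ _⟩⟩
  | one =>
    have : Unique (WordOrder {[]}) := ⟨⟨⟨[], rfl⟩⟩, fun x => Subtype.ext x.2⟩
    exact ⟨{[]}, .singleton_nil, ⟨OrderIso.ofUnique _ _⟩⟩
  | add L₀ L₁ _ _ ih₀ ih₁ =>
    obtain ⟨S₀, h₀, ⟨e₀⟩⟩ := ih₀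
    obtain ⟨S₁, h₁, ⟨e₁⟩⟩ := ih₁
    obtain ⟨e⟩ := WordOrder.nonempty_sumLex_orderIso_branch fun a => cond a S₁ S₀
    exact ⟨_, .branch (by rintro (_ | _); exacts [h₀, h₁]),
      ⟨(OrderIso.sumLexCongr e₀ e₁).trans e⟩⟩
  | mul_omega L _ ih =>
    obtain ⟨S, h, ⟨e⟩⟩ := ih
    obtain ⟨e'⟩ := WordOrder.nonempty_prodLex_nat_orderIso_loopThen S
    exact ⟨_, h.loopThen true, ⟨(Prod.Lex.prodLexCongr (.refl _) e).trans e'⟩⟩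
  | mul_omega_star L _ ih =>
    obtain ⟨S, h, ⟨e⟩⟩ := ih
    obtain ⟨e'⟩ := WordOrder.nonempty_prodLex_natDual_orderIso_loopThen S
    exact ⟨_, h.loopThen false, ⟨(Prod.Lex.prodLexCongr (.refl _) e).trans e'⟩⟩
  | shuffle n L χ hχ _ ih =>
    obtain _ | n := n
    · exact (χ 0).elim0
    choose A hA e using ih
    -- The given colouring of ℚ is replaced by the depth colouring of the binary tree, whose sum is
    -- regular.
    obtain ⟨i, hi⟩ := hχ.isDenseColoring.exists_orderIso (BinWord.isDenseColoring_depthColor 0)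
    obtain ⟨e₁⟩ : Nonempty ((Σₗ r : ℚ, L (χ r)) ≃o
        Σₗ u : BinWord, WordOrder (A (depthColor 0 u))) := by
      refine nonempty_sigmaLex_congr i fun r => ?_
      rw [hi]
      exact e (χ r)
    obtain ⟨e₂⟩ := WordOrder.nonempty_sigmaLex_orderIso_treeSum (A := A) 0
    exact ⟨_, .treeSum hA 0, ⟨e₁.trans e₂⟩⟩
  | iso L L' e _ ih =>
    obtain ⟨S, h, ⟨e'⟩⟩ := ih
    exact ⟨S, h, ⟨e.symm.trans e'⟩⟩

/-! ### Decomposition of a language along a strongly connected component -/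

/-- The words that can be read after `u`. -/
def wordQuotient (T : Set (List Bool)) (u : List Bool) : Set (List Bool) := {w | u ++ w ∈ T}

theorem wordQuotient_nil (T : Set (List Bool)) : wordQuotient T [] = T := rfl

theorem wordQuotient_append (T : Set (List Bool)) (u v : List Bool) :
    wordQuotient T (u ++ v) = wordQuotient (wordQuotient T u) v := by
  ext w
  simp [wordQuotient]

namespace Component

open scoped Classical in
/-- The position of a word `w` relative to the walks `u` from `T` inside `C` that end in a
language with both letter quotients in `C`. The value `inl false` means before all of them,
`inl true` means after all of them, and `inr u` means that `w` belongs to the cluster of `u`. -/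
noncomputable def position (C : Set (Set (List Bool))) :
    Set (List Bool) → List Bool → Bool ⊕ List Bool
  | T, [] =>
    if letterQuotient false T ∉ C then .inl false
    else if letterQuotient true T ∉ C then .inl true else .inr []
  | T, a :: w =>
    if letterQuotient a T ∉ C then .inl a
    else match position C (letterQuotient a T) w with
      | .inl e =>
        if e = a then .inl a else if letterQuotient (!a) T ∈ C then .inr [] else .inl e
      | .inr u => .inr (a :: u)

/-- The order on positions. -/
def PositionLE : Bool ⊕ List Bool → Bool ⊕ List Bool → Prop
  | .inl false, _ => True
  | _, .inl true => True
  | .inr u, .inr v => u = v ∨ InorderLT u v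
  | _, _ => False

variable {C : Set (Set (List Bool))}

/-- This makes the end parts and clusters convex and orders the clusters like their walks. Any `C`
will do, since the recursion looks only at the first letters and at which letter quotients lie in
`C`. -/
theorem position_mono : ∀ (w w' : List Bool) (T : Set (List Bool)), InorderLT w w' →
    PositionLE (position C T w) (position C T w')
  | [], [], _, h => absurd h not_inorderLT_nil_nil
  | [], b :: w', T, h => by
    rw [inorderLT_nil_cons] at h
    subst h
    rw [position, position]
    rcases position C (letterQuotient true T) w' with (_ | _) | u <;>
    by_cases h0 : letterQuotient false T ∈ C <;> by_cases h1 : letterQuotient true T ∈ C <;>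
    simp [h0, h1, PositionLE, inorderLT_nil_cons]
  | a :: w, [], T, h => by
    rw [inorderLT_cons_nil] at h
    subst h
    rw [position, position]
    rcases position C (letterQuotient false T) w with (_ | _) | u <;>
    by_cases h0 : letterQuotient false T ∈ C <;> by_cases h1 : letterQuotient true T ∈ C <;>
    simp [h0, h1, PositionLE, inorderLT_cons_nil]
  | a :: w, b :: w', T, h => by
    rw [inorderLT_cons_cons] at h
    rw [position, position]
    rcases h with ⟨rfl, rfl⟩ | ⟨rfl, h⟩
    · rcases position C (letterQuotient false T) w with (_ | _) | u <;>
      rcases position C (letterQuotient true T) w' with (_ | _) | v <;>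
      by_cases h0 : letterQuotient false T ∈ C <;> by_cases h1 : letterQuotient true T ∈ C <;>
      simp [h0, h1, PositionLE, inorderLT_cons_nil, inorderLT_nil_cons, inorderLT_cons_cons]
    · have ih := position_mono w w' (letterQuotient a T) h
      revert ih
      rcases position C (letterQuotient a T) w with (_ | _) | u <;>
      rcases position C (letterQuotient a T) w' with (_ | _) | v <;>
      cases a <;>
      by_cases h0 : letterQuotient false T ∈ C <;> by_cases h1 : letterQuotient true T ∈ C <;>
      simp [h0, h1, PositionLE, inorderLT_cons_nil, inorderLT_nil_cons, inorderLT_cons_cons]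

/-- The words of `T` that lie before or after all clusters. -/
def endPart (C : Set (Set (List Bool))) (e : Bool) (T : Set (List Bool)) : Set (List Bool) :=
  {w | w ∈ T ∧ position C T w = .inl e}

/-- The words of `T` in the cluster of the walk `u`. -/
def cluster (C : Set (Set (List Bool))) (T : Set (List Bool)) (u : List Bool) :
    Set (List Bool) :=
  {w | w ∈ T ∧ position C T w = .inr u}

/-! #### The end parts -/

/-- This and the next lemmas show that an end part has a single spine. If `e` stays in `C`, all its
words begin with `e`. Otherwise the words beginning with `e` leave `C` at once, and the spine goes
on along the other letter. -/
theorem letterQuotient_endPart_self (e : Bool) (T : Set (List Bool))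
    (h : letterQuotient e T ∈ C) :
    letterQuotient e (endPart C e T) = endPart C e (letterQuotient e T) := by
  ext w
  simp only [endPart, mem_letterQuotient, Set.mem_ofPred_eq, position]
  rcases position C (letterQuotient e T) w with (_ | _) | u <;> cases e <;> simp [h] <;> grind

theorem letterQuotient_endPart_self_of_notMem (e : Bool) (T : Set (List Bool))
    (h : letterQuotient e T ∉ C) :
    letterQuotient e (endPart C e T) = letterQuotient e T := by
  ext w
  simp [endPart, position, h]

theorem letterQuotient_not_endPart (e : Bool) (T : Set (List Bool))
    (h : letterQuotient e T ∈ C) :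
    letterQuotient (!e) (endPart C e T) = ∅ := by
  ext w
  simp only [endPart, mem_letterQuotient, Set.mem_ofPred_eq, position]
  rcases position C (letterQuotient (!e) T) w with (_ | _) | u <;> cases e <;> simp [h] <;> grind

theorem letterQuotient_not_endPart_of_notMem (e : Bool) (T : Set (List Bool))
    (h : letterQuotient e T ∉ C) (h' : letterQuotient (!e) T ∈ C) :
    letterQuotient (!e) (endPart C e T) = endPart C e (letterQuotient (!e) T) := by
  ext w
  simp only [endPart, mem_letterQuotient, Set.mem_ofPred_eq, position]
  rcases position C (letterQuotient (!e) T) w with (_ | _) | u <;> cases e <;> simp_all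

theorem nil_notMem_endPart (e : Bool) (T : Set (List Bool)) (h : letterQuotient e T ∈ C) :
    [] ∉ endPart C e T := by
  cases e <;> simp only [endPart, position, h, Set.mem_ofPred_eq, not_true, if_false] <;>
    split_ifs <;> simp

open scoped Classical in
/-- The letter along which the end part on the side `e` continues inside `C`. -/
noncomputable def endLetter (C : Set (Set (List Bool))) (e : Bool) (T : Set (List Bool)) : Bool :=
  if letterQuotient e T ∈ C then e else !e

/-- The next language on the outermost walk inside `C`. -/
noncomputable def endNext (C : Set (Set (List Bool))) (e : Bool) (T : Set (List Bool)) :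
    Set (List Bool) :=
  letterQuotient (endLetter C e T) T

/-- The labels of the first `n` steps of the outermost walk inside `C`. -/
noncomputable def endPath (C : Set (Set (List Bool))) (e : Bool) :
    ℕ → Set (List Bool) → List Bool
  | 0, _ => []
  | n + 1, T => endLetter C e T :: endPath C e n (endNext C e T)

theorem endNext_mem {e : Bool} {T : Set (List Bool)} (h : ∃ a, letterQuotient a T ∈ C) :
    endNext C e T ∈ C := by
  obtain ⟨a, ha⟩ := h
  unfold endNext endLetter
  split_ifs with he
  · exact he
  · cases a <;> cases e <;> simp_all

theorem letterQuotient_endLetter_endPart {e : Bool} {T : Set (List Bool)}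
    (h : ∃ a, letterQuotient a T ∈ C) :
    letterQuotient (endLetter C e T) (endPart C e T) = endPart C e (endNext C e T) := by
  have hn := endNext_mem (e := e) h
  unfold endNext endLetter at *
  split_ifs at * with he
  · exact letterQuotient_endPart_self e T he
  · exact letterQuotient_not_endPart_of_notMem e T he hn

/-- `x` is strictly closer to the end `e` than `y`. -/
def EndLT : Bool → List Bool → List Bool → Prop
  | false, x, y => InorderLT x y
  | true, x, y => InorderLT y x

theorem endLT_nil_cons (e b : Bool) (y : List Bool) : EndLT e [] (b :: y) ↔ b = !e := by
  cases e <;> simp [EndLT, inorderLT_nil_cons, inorderLT_cons_nil]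

theorem endLT_cons_cons (e a b : Bool) (x y : List Bool) :
    EndLT e (a :: x) (b :: y) ↔ (a = e ∧ b = !e) ∨ (a = b ∧ EndLT e x y) := by
  cases e <;> simp [EndLT, inorderLT_cons_cons, and_comm, eq_comm]

variable (hin : ∀ T ∈ C, ∃ a, letterQuotient a T ∈ C)
include hin

theorem endPath_append_mem_endPart {e : Bool} (n : ℕ) {T : Set (List Bool)} (hT : T ∈ C)
    (w : List Bool) :
    endPath C e n T ++ w ∈ endPart C e T ↔ w ∈ endPart C e ((endNext C e)^[n] T) := by
  induction n generalizing T with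
  | zero => rfl
  | succ n ih =>
    rw [Function.iterate_succ_apply, ← ih (endNext_mem (hin T hT)),
      ← letterQuotient_endLetter_endPart (hin T hT)]
    rfl

/-- The outermost walk turns away from the end `e` only where `e` leaves `C`. A word of the end part
that quits the walk does so there, by stopping or by reading `e`, and both put it nearer to the end.
-/
theorem endLT_endPath_append {e : Bool} (n : ℕ) {T : Set (List Bool)} (hT : T ∈ C)
    (x y : List Bool) (hx : x ∈ WordOrder.noPrefix (endPart C e T) (endPath C e n T)) :
    EndLT e x (endPath C e n T ++ y) := by
  induction n generalizing T x with
  | zero => exact absurd List.nil_prefix hx.2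
  | succ n ih =>
    obtain ⟨hx, hp⟩ := hx
    rw [endPath] at hp ⊢
    rw [List.cons_append]
    rcases x with _ | ⟨a, x⟩
    · rw [endLT_nil_cons]
      by_cases he : letterQuotient e T ∈ C
      · exact absurd hx (nil_notMem_endPart e T he)
      · simp [endLetter, he]
    · rw [endLT_cons_cons]
      by_cases ha : a = endLetter C e T
      · refine Or.inr ⟨ha, ih (endNext_mem (hin T hT)) x ⟨?_, ?_⟩⟩
        · rwa [← letterQuotient_endLetter_endPart (hin T hT), ← ha]
        · rw [ha, List.cons_prefix_cons] at hp
          exact fun h => hp ⟨rfl, h⟩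
      · by_cases he : letterQuotient e T ∈ C
        · rw [endLetter, if_pos he] at ha
          obtain rfl : a = !e := by cases a <;> cases e <;> simp_all
          change x ∈ letterQuotient (!e) (endPart C e T) at hx
          rw [letterQuotient_not_endPart e T he] at hx
          exact hx.elim
        · rw [endLetter, if_neg he] at ha ⊢
          exact Or.inl ⟨by cases a <;> cases e <;> simp_all, rfl⟩

variable (hout : ∀ T ∈ C, ∀ a, letterQuotient a T ∉ C →
  IsFiniteDescription (WordOrder (letterQuotient a T)))
include hout

omit hin in
theorem isFiniteDescription_letterQuotient_endPart {e a : Bool} {T : Set (List Bool)}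
    (hT : T ∈ C) (ha : a ≠ endLetter C e T) :
    IsFiniteDescription (WordOrder (letterQuotient a (endPart C e T))) := by
  by_cases he : letterQuotient e T ∈ C
  · rw [endLetter, if_pos he] at ha
    obtain rfl : a = !e := by cases a <;> cases e <;> simp_all
    rw [letterQuotient_not_endPart e T he]
    exact .wordOrder_of_subsingleton Set.subsingleton_empty
  · rw [endLetter, if_neg he] at ha
    obtain rfl : a = e := by cases a <;> cases e <;> simp_all
    rw [letterQuotient_endPart_self_of_notMem a T he]
    exact hout T hT a he

/-- Along a walk of length `n` there are finitely many exits, each covered by `hout`, and at most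
one word stopping at each step. -/
theorem isFiniteDescription_noPrefix_endPath {e : Bool} (n : ℕ) {T : Set (List Bool)}
    (hT : T ∈ C) :
    IsFiniteDescription (WordOrder (WordOrder.noPrefix (endPart C e T) (endPath C e n T))) := by
  induction n generalizing T with
  | zero => exact .wordOrder_of_subsingleton fun x hx => absurd List.nil_prefix hx.2
  | succ n ih =>
    refine .wordOrder_of_letterQuotient fun a => ?_
    by_cases ha : a = endLetter C e T
    · subst ha
      have h : letterQuotient (endLetter C e T)
          (WordOrder.noPrefix (endPart C e T) (endPath C e (n + 1) T)) =
          WordOrder.noPrefix (endPart C e (endNext C e T)) (endPath C e n (endNext C e T)) := by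
        rw [← letterQuotient_endLetter_endPart (hin T hT)]
        ext w
        simp [WordOrder.noPrefix, endPath]
      rw [h]
      exact ih (endNext_mem (hin T hT))
    · have h : letterQuotient a (WordOrder.noPrefix (endPart C e T) (endPath C e (n + 1) T)) =
          letterQuotient a (endPart C e T) := by
        ext w
        simp only [WordOrder.noPrefix, endPath, mem_letterQuotient, Set.mem_ofPred_eq,
          List.cons_prefix_cons]
        exact ⟨fun h => h.1, fun h => ⟨h, fun h' => ha h'.1.symm⟩⟩
      rw [h]
      exact isFiniteDescription_letterQuotient_endPart hout hT ha

theorem isFiniteDescription_endPart_of_iterate {e : Bool} (n : ℕ) {T : Set (List Bool)}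
    (hT : T ∈ C) (h : IsFiniteDescription (WordOrder (endPart C e ((endNext C e)^[n] T)))) :
    IsFiniteDescription (WordOrder (endPart C e T)) := by
  induction n generalizing T with
  | zero => exact h
  | succ n ih =>
    refine .wordOrder_of_letterQuotient fun a => ?_
    by_cases ha : a = endLetter C e T
    · rw [ha, letterQuotient_endLetter_endPart (hin T hT)]
      exact ih (endNext_mem (hin T hT)) h
    · exact isFiniteDescription_letterQuotient_endPart hout hT ha

/-- Prefixing one period preserves the end part. The further copies move away from the end `e`:
upwards for the initial part, giving ω, and downwards for the final part, giving ω*. -/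
theorem isFiniteDescription_endPart_of_periodic {e : Bool} {n : ℕ} {T : Set (List Bool)}
    (hT : T ∈ C) (h : (endNext C e)^[n + 1] T = T) :
    IsFiniteDescription (WordOrder (endPart C e T)) := by
  have hv : endPath C e (n + 1) T ≠ [] := by simp [endPath]
  have hS : ∀ w, endPath C e (n + 1) T ++ w ∈ endPart C e T ↔ w ∈ endPart C e T := fun w => by
    rw [endPath_append_mem_endPart hin _ hT, h]
  have hlt := endLT_endPath_append hin (e := e) (n + 1) hT
  have hfd := isFiniteDescription_noPrefix_endPath hin hout (e := e) (n + 1) hT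
  cases e
  · obtain ⟨i⟩ := WordOrder.nonempty_prodLex_nat_orderIso hv hS fun x hx y _ => hlt x y hx
    exact .iso _ _ i (.mul_omega _ hfd)
  · obtain ⟨i⟩ := WordOrder.nonempty_prodLex_natDual_orderIso hv hS fun x hx y _ => hlt x y hx
    exact .iso _ _ i (.mul_omega_star _ hfd)

theorem isFiniteDescription_endPart (hC : C.Finite) (e : Bool) {T : Set (List Bool)}
    (hT : T ∈ C) : IsFiniteDescription (WordOrder (endPart C e T)) := by
  have hmem : ∀ n, (endNext C e)^[n] T ∈ C := fun n => by
    induction n with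
    | zero => exact hT
    | succ n ih =>
      rw [Function.iterate_succ_apply']
      exact endNext_mem (hin _ ih)
  have := hC.to_subtype
  -- By the pigeonhole principle the outermost walk repeats a language: `i` steps of preperiod, then
  -- a period `k + 1`, which is positive.
  obtain ⟨i, j, hij, he⟩ := Finite.exists_ne_map_eq_of_infinite
    fun n => (⟨_, hmem n⟩ : C)
  wlog hlt : i < j generalizing i j
  · exact this j i hij.symm he.symm (by omega)
  obtain ⟨k, rfl⟩ := Nat.exists_eq_add_of_lt hlt
  refine isFiniteDescription_endPart_of_iterate hin hout i hT
    (isFiniteDescription_endPart_of_periodic hin hout (n := k) (hmem i) ?_)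
  rw [← Function.iterate_add_apply, add_comm, ← add_assoc]
  exact (congrArg Subtype.val he).symm

/-! #### The clusters -/

theorem isFiniteDescription_cluster_nil (hC : C.Finite) {T : Set (List Bool)}
    (h : ∀ a, letterQuotient a T ∈ C) : IsFiniteDescription (WordOrder (cluster C T [])) := by
  refine .wordOrder_of_letterQuotient fun a => ?_
  -- The root cluster lies between the two subtrees: it takes the final part of the left one and the
  -- initial part of the right one.
  have he : letterQuotient a (cluster C T []) = endPart C (!a) (letterQuotient a T) := by
    ext w
    simp only [cluster, endPart, mem_letterQuotient, Set.mem_ofPred_eq, position]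
    rcases position C (letterQuotient a T) w with (_ | _) | u <;> cases a <;> simp [h]
  rw [he]
  exact isFiniteDescription_endPart hin hout hC (!a) (h a)

omit hin hout

/-- Along the word `u` all quotients of `T` belong to `C`. -/
def StaysIn (C : Set (Set (List Bool))) : Set (List Bool) → List Bool → Prop
  | T, [] => T ∈ C
  | T, a :: u => T ∈ C ∧ StaysIn C (letterQuotient a T) u

theorem StaysIn.mem {T : Set (List Bool)} {u : List Bool} (h : StaysIn C T u) : T ∈ C := by
  cases u
  · exact h
  · exact h.1

theorem StaysIn.append {T : Set (List Bool)} {u v : List Bool} (hu : StaysIn C T u)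
    (hv : StaysIn C (wordQuotient T u) v) : StaysIn C T (u ++ v) := by
  induction u generalizing T with
  | nil => exact hv
  | cons a u ih => exact ⟨hu.1, ih hu.2 hv⟩

theorem StaysIn.wordQuotient_mem {T : Set (List Bool)} {u : List Bool} (hu : StaysIn C T u) :
    wordQuotient T u ∈ C := by
  induction u generalizing T with
  | nil => exact hu
  | cons a u ih => exact ih hu.2

/-- The walks inside `C` that start in `T` and can be continued inside `C` by both letters. -/
def branchings (C : Set (Set (List Bool))) (T : Set (List Bool)) : Set (List Bool) :=
  {u | StaysIn C T u ∧ ∀ a, letterQuotient a (wordQuotient T u) ∈ C}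

theorem mem_branchings_of_position_eq {T : Set (List Bool)} (hT : T ∈ C) {w u : List Bool}
    (h : position C T w = .inr u) : u ∈ branchings C T := by
  induction w generalizing T u with
  | nil =>
    rw [position] at h
    split_ifs at h with h0 h1
    obtain rfl : [] = u := Sum.inr.inj h
    exact ⟨hT, by rintro (_ | _) <;> simp_all [wordQuotient_nil]⟩
  | cons a w ih =>
    rw [position] at h
    by_cases ha : letterQuotient a T ∉ C
    · simp [ha] at h
    rw [if_neg ha] at h
    rw [not_not] at ha
    split at h
    · split_ifs at h with h1 h2
      obtain rfl : [] = u := Sum.inr.inj h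
      exact ⟨hT, by rintro (_ | _) <;> cases a <;> simp_all [wordQuotient_nil]⟩
    · next v hv =>
      obtain rfl : a :: v = u := Sum.inr.inj h
      exact ⟨⟨hT, (ih ha hv).1⟩, (ih ha hv).2⟩

/-- The cluster of `u` is the root cluster of the quotient by `u`, prefixed by `u`. So there are
only as many isomorphism types as branching languages in `C`. -/
theorem nonempty_orderIso_cluster {T : Set (List Bool)} {u : List Bool} (h : StaysIn C T u) :
    Nonempty (WordOrder (cluster C (wordQuotient T u) []) ≃o WordOrder (cluster C T u)) := by
  induction u generalizing T with
  | nil => exact ⟨.refl _⟩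
  | cons b u ih =>
    obtain ⟨i⟩ := ih h.2
    obtain ⟨j⟩ : Nonempty (WordOrder (cluster C (letterQuotient b T) u) ≃o
        WordOrder (cluster C T (b :: u))) := by
      refine WordOrder.nonempty_orderIso_cons b ?_
      have hb := h.2.mem
      ext w
      rcases w with _ | ⟨a, w⟩
      · simp only [cluster, position, Set.mem_ofPred_eq]
        split_ifs <;> simp
      · by_cases hab : a = b
        · subst hab
          simp only [cluster, position, Set.mem_ofPred_eq, Set.mem_image, List.cons.injEq, true_and,
            exists_eq_right, mem_letterQuotient, hb, not_true, if_false]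
          rcases position C (letterQuotient a T) w with e | v
          · simp only
            split_ifs <;> simp
          · simp
        · simp only [cluster, position, Set.mem_ofPred_eq, Set.mem_image, List.cons.injEq]
          rcases position C (letterQuotient a T) w with e | v
          · split_ifs <;> simp [Ne.symm hab] <;> split_ifs <;> simp
          · split_ifs <;> simp [hab, Ne.symm hab]
    exact ⟨i.trans j⟩

/-! ### The clusters as a shuffle -/

/-- The words of `T` in some cluster. -/
def middle (C : Set (Set (List Bool))) (T : Set (List Bool)) : Set (List Bool) :=
  {w | w ∈ T ∧ ∃ u, position C T w = .inr u}

variable (hconn : ∀ T ∈ C, ∀ T' ∈ C, ∃ v, StaysIn C T v ∧ wordQuotient T v = T')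

include hin hout hconn in
theorem isFiniteDescription_middle (hC : C.Finite) {T : Set (List Bool)} (hT : T ∈ C) :
    IsFiniteDescription (WordOrder (middle C T)) := by
  let f : WordOrder (middle C T) → WordOrder (branchings C T) := fun x =>
    ⟨x.2.2.choose, mem_branchings_of_position_eq hT x.2.2.choose_spec⟩
  have hf : ∀ x, position C T x.1 = .inr (f x).1 := fun x => x.2.2.choose_spec
  cases isEmpty_or_nonempty (WordOrder (branchings C T)) with
  | inl h =>
    have := f.isEmpty
    exact .of_isEmpty _
  | inr h =>
    have : Finite {B // B ∈ C ∧ ∀ a, letterQuotient a B ∈ C} :=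
      (hC.subset (Set.sep_subset C fun B => ∀ a, letterQuotient a B ∈ C)).to_subtype
    -- The colour of a branching walk is the language it reaches.
    let c : WordOrder (branchings C T) → {B // B ∈ C ∧ ∀ a, letterQuotient a B ∈ C} :=
      fun u => ⟨wordQuotient T u.1, u.2.1.wordQuotient_mem, u.2.2⟩
    have hc : IsDenseColoring c := by
      refine WordOrder.isDenseColoring ?_
      rintro ⟨B, hB, hB'⟩ x hx a
      -- Both continuations of a branching walk stay in `C`, and from either one every branching
      -- language can be reached inside `C`.
      obtain ⟨v, hv, rfl⟩ := hconn _ (hx.2 a) B hB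
      have he : wordQuotient T (x ++ a :: v) =
        wordQuotient (letterQuotient a (wordQuotient T x)) v := wordQuotient_append _ _ _
      refine ⟨v, ⟨hx.1.append ⟨hx.1.wordQuotient_mem, hv⟩, ?_⟩, Subtype.ext he⟩
      rwa [he]
    refine .of_isDenseColoring hc (X := fun k => WordOrder (cluster C k.1 []))
      (fun k => isFiniteDescription_cluster_nil hin hout hC k.2.2) (f := f) ?_ fun d => ?_
    · intro x y hxy
      rcases hxy.eq_or_lt with rfl | hxy
      · exact le_rfl
      · have := position_mono (C := C) x.1 y.1 T hxy
        rw [hf, hf] at this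
        rcases this with h | h
        · exact (Subtype.ext h : f x = f y).le
        · exact le_of_lt (show f x < f y from h)
    · obtain ⟨i⟩ := nonempty_orderIso_cluster d.2.1
      obtain ⟨j⟩ : Nonempty (WordOrder (cluster C T d.1) ≃o {x // f x = d}) := by
        refine nonempty_orderIso_of_strictMono (f := fun w : WordOrder (cluster C T d.1) =>
          (⟨⟨w.1, w.2.1, d.1, w.2.2⟩, ?_⟩ : {x // f x = d})) ?_ ?_
        · exact Subtype.ext (Sum.inr.inj ((hf _).symm.trans w.2.2))
        · exact fun x y h => h
        · rintro ⟨x, rfl⟩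
          exact ⟨⟨x.1, x.2.1, hf x⟩, rfl⟩
      exact ⟨i.trans j⟩

include hin hout hconn in
/-- A strongly connected component of languages that has finite description exits consists of
finite description orders. -/
theorem isFiniteDescription_wordOrder (hC : C.Finite) {T : Set (List Bool)} (hT : T ∈ C) :
    IsFiniteDescription (WordOrder T) := by
  -- Monotonicity in contrapositive form: positions that are strictly apart force the order of the
  -- words.
  have hlt : ∀ x y, ¬ PositionLE (position C T y) (position C T x) → InorderLT x y := by
    intro x y h
    rcases inorderLT_trichotomous x y with hxy | rfl | hxy
    · exact hxy
    · refine absurd ?_ h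
      rcases position C T x with (_ | _) | u <;> simp [PositionLE]
    · exact absurd (position_mono y x T hxy) h
  refine .wordOrder_union (A := endPart C false T) (B := middle C T ∪ endPart C true T) ?_ ?_
    (isFiniteDescription_endPart hin hout hC false hT)
    (.wordOrder_union rfl ?_ (isFiniteDescription_middle hin hout hconn hC hT)
      (isFiniteDescription_endPart hin hout hC true hT))
  · ext w
    simp only [endPart, middle, Set.mem_union, Set.mem_ofPred_eq, ← and_or_left]
    rcases position C T w with (_ | _) | u <;> simp
  · rintro x hx y (⟨-, u, hy⟩ | hy) <;> apply hlt
    · rw [hx.2, hy]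
      simp [PositionLE]
    · rw [hx.2, hy.2]
      simp [PositionLE]
  · rintro x ⟨-, u, hx⟩ y hy
    apply hlt
    rw [hx, hy.2]
    simp [PositionLE]

end Component

/-! ### Regular languages are finite description orders -/

theorem HasFiniteQuotients.finite_range_wordQuotient {S : Set (List Bool)}
    (h : HasFiniteQuotients S) : (Set.range (wordQuotient S)).Finite := by
  obtain ⟨F, hF, hS, hcl⟩ := h
  refine hF.subset ?_
  rintro _ ⟨u, rfl⟩
  induction u generalizing S with
  | nil => exact hS
  | cons a u ih => exact ih (hcl S hS a)

theorem range_wordQuotient_subset {S T : Set (List Bool)} (h : T ∈ Set.range (wordQuotient S)) :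
    Set.range (wordQuotient T) ⊆ Set.range (wordQuotient S) := by
  obtain ⟨u, rfl⟩ := h
  rintro _ ⟨v, rfl⟩
  exact ⟨u ++ v, wordQuotient_append S u v⟩

theorem letterQuotient_mem_range_wordQuotient (S : Set (List Bool)) (a : Bool) :
    letterQuotient a S ∈ Set.range (wordQuotient S) := ⟨[a], rfl⟩

/-- A quotient of `S` from which `S` cannot be recovered lacks at least the quotient `S`, so the
induction on the number of quotients applies to every exit from the component of `S`. -/
theorem IsFiniteDescription.wordOrder_of_finite_range (S : Set (List Bool))
    (h : (Set.range (wordQuotient S)).Finite) : IsFiniteDescription (WordOrder S) := by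
  induction hn : (Set.range (wordQuotient S)).ncard using Nat.strong_induction_on
    generalizing S with | _ n ih
  have hsmall : ∀ T ∈ Set.range (wordQuotient S), S ∉ Set.range (wordQuotient T) →
      IsFiniteDescription (WordOrder T) := by
    intro T hT hS
    have hsub := range_wordQuotient_subset hT
    refine ih _ ?_ T (h.subset hsub) rfl
    rw [← hn]
    exact Set.ncard_lt_ncard ⟨hsub, fun h' => hS (h' ⟨[], rfl⟩)⟩ h
  let C : Set (Set (List Bool)) :=
    {T | T ∈ Set.range (wordQuotient S) ∧ S ∈ Set.range (wordQuotient T)}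
  have hSC : S ∈ C := ⟨⟨[], rfl⟩, ⟨[], rfl⟩⟩
  have hstep : ∀ T ∈ C, ∀ a, letterQuotient a T ∈ Set.range (wordQuotient S) := fun T hT a =>
    range_wordQuotient_subset hT.1 (letterQuotient_mem_range_wordQuotient T a)
  have hout : ∀ T ∈ C, ∀ a, letterQuotient a T ∉ C →
      IsFiniteDescription (WordOrder (letterQuotient a T)) := fun T hT a ha =>
    hsmall _ (hstep T hT a) fun h => ha ⟨hstep T hT a, h⟩
  -- If no letter keeps `S` in its component, there is no walk to follow, and `S` is assembled
  -- directly from its two exits.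
  by_cases hS : ∃ a, letterQuotient a S ∈ C
  · refine Component.isFiniteDescription_wordOrder (C := C) ?_ hout ?_
      (h.subset fun T hT => hT.1) hSC
    · intro T hT
      obtain ⟨_ | ⟨a, u⟩, hu⟩ := hT.2
      · obtain rfl : T = S := hu
        exact hS
      · exact ⟨a, hstep T hT a, u, hu⟩
    -- Every language passed on a walk from a quotient of `S` to a member of `C` can still reach
    -- `S`, hence lies in `C`.
    · have hstay : ∀ (v : List Bool) (T : Set (List Bool)), T ∈ Set.range (wordQuotient S) →
          wordQuotient T v ∈ C → Component.StaysIn C T v := by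
        intro v
        induction v with
        | nil => exact fun T _ h => h
        | cons a v ih' =>
          intro T hT hv
          have hTC : T ∈ C := ⟨hT, range_wordQuotient_subset ⟨_, rfl⟩ hv.2⟩
          exact ⟨hTC, ih' _ (hstep T hTC a) hv⟩
      intro T hT T' hT'
      obtain ⟨v, rfl⟩ := range_wordQuotient_subset hT.2 hT'.1
      exact ⟨v, hstay v T hT.1 hT', rfl⟩
  · exact .wordOrder_of_letterQuotient fun a => hout S hSC a fun ha => hS ⟨a, ha⟩

/-- A linear order is a finite description linear order if and only if it is isomorphic to the
linguage of some finite automaton over `{0, 1}`. -/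
theorem theorem5 (L : Type u) [LinearOrder L] :
    IsFiniteDescription L ↔
      ∃ (Q : Type) (_ : Finite Q) (M : PartialDFA Bool Q), Nonempty (L ≃o M.Linguage) := by
  constructor
  · intro h
    obtain ⟨S, hS, e⟩ := h.exists_wordOrder
    obtain ⟨Q, hQ, M, rfl⟩ := hS.exists_partialDFA
    exact ⟨Q, hQ, M, e⟩
  · rintro ⟨Q, _, M, ⟨e⟩⟩
    have h : IsFiniteDescription M.Linguage := .wordOrder_of_finite_range _
      M.hasFiniteQuotients_language.finite_range_wordQuotient
    -- The linguage lives in `Type`, so an isomorphic finite description order in the universe of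
    -- `L` is needed.
    obtain ⟨L', _, hL', ⟨e'⟩⟩ := h.exists_orderIso
    exact .iso _ _ (e.trans e').symm hL'
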